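/- Call a group $\Delta$ linear over $\mathbb{R}$ if it embeds in $\mathsf{GL}_m(\mathbb{R})$ for some $m \in \mathbb{N}$. A subgroup $\Lambda$ of a group $\Gamma$ is separable in $\Gamma$ if it is an intersection of finite-index subgroups of $\Gamma$. The double $\Gamma \ast_\Lambda \Gamma$ is the amalgamated free product of two copies of $\Gamma$ along the inclusion of $\Lambda$ into either factor. (1) Let $V$ be a finite-dimensional real vector space, let $\Gamma < \mathsf{GL}(V)$ be a subgroup, and let $\mathsf{L} < \mathsf{GL}(V)$ be a compact subgroup. Then for every finite-index subgroup $\Lambda$ of $\Gamma \cap \mathsf{L}$ that is separable in $\Gamma$, the double $\Gamma \ast_\Lambda \Gamma$ is linear over $\mathbb{R}$. (2) Let $\Gamma < \mathsf{GL}_n(\mathbb{C})$ be a subgroup, and let $K \subset \mathbb{C}$ be its entry field, i.e., the subfield of $\mathbb{C}$ generated by all entries of all elements of $\Gamma$. Let $\mathsf{G}$ be an algebraic subgroup of $\mathsf{GL}_n(\mathbb{C})$, i.e., a subgroup that is the common zero locus in $\mathsf{GL}_n(\mathbb{C})$ of a set of polynomials over $\mathbb{C}$ in the matrix entries, and let $\Lambda$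 be a finite-index subgroup of $\Gamma \cap \mathsf{G}$ that is separable in $\Gamma$. If there is a field embedding $\sigma : K \to \mathbb{C}$ such that $(\Gamma \cap \mathsf{G})^\sigma$, the group obtained from $\Gamma \cap \mathsf{G}$ by applying $\sigma$ to all matrix entries, has compact closure in $\mathsf{GL}_n(\mathbb{C})$, then the double $\Gamma \ast_\Lambda \Gamma$ is linear over $\mathbb{R}$. -/

import Mathlib

namespace LinearDoubles

/-- The double of a group `Γ` along a subgroup `Λ`: the amalgamated free product of two copies of
`Γ` over `Λ`, with the inclusion of `Λ` into either factor. -/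
abbrev Double {Γ : Type*} [Group Γ] (Λ : Subgroup Γ) : Type _ :=
  Monoid.PushoutI (fun _ : Fin 2 => Λ.subtype)

/-- `Λ` is separable in `Γ`: it is an intersection of finite-index subgroups of `Γ`. -/
def IsSeparableSubgroup {Γ : Type*} [Group Γ] (Λ : Subgroup Γ) : Prop :=
  ∃ S : Set (Subgroup Γ), (∀ H ∈ S, H.FiniteIndex) ∧ Λ = sInf S

/-- A group is linear over `R` if it embeds in `GL_n(R)` for some `n`. -/
def IsLinearOver (R : Type*) [CommRing R] (Γ : Type*) [Group Γ] : Prop :=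
  ∃ (n : ℕ) (ρ : Γ →* Matrix.GeneralLinearGroup (Fin n) R), Function.Injective ρ

/-- The usual topology of `GL(V)`, for `V` a finite-dimensional real vector space: `End(V)` carries
its canonical vector space topology (the module topology), and `GL(V)` the topology of the group of
units of the topological ring `End(V)`. -/
@[reducible]
def glTopology (V : Type*) [AddCommGroup V] [Module ℝ V] :
    TopologicalSpace (LinearMap.GeneralLinearGroup ℝ V) :=
  @Units.instTopologicalSpaceUnits (Module.End ℝ V) (moduleTopology ℝ (Module.End ℝ V)) _

/-- `L` is a compact subgroup of `GL(V)`. -/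
def IsCompactSubgroup {V : Type*} [AddCommGroup V] [Module ℝ V]
    (L : Subgroup (LinearMap.GeneralLinearGroup ℝ V)) : Prop :=
  @IsCompact _ (glTopology V) (L : Set (LinearMap.GeneralLinearGroup ℝ V))

/-- `G` is an algebraic subgroup of `GL_n(k)`: it is the common zero locus in `GL_n(k)` of a set of
polynomials over `k` in the matrix entries. -/
def IsAlgebraicSubgroup {n : ℕ} {k : Type*} [Field k]
    (G : Subgroup (Matrix.GeneralLinearGroup (Fin n) k)) : Prop :=
  ∃ S : Set (MvPolynomial (Fin n × Fin n) k), ∀ g : Matrix.GeneralLinearGroup (Fin n) k,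
    g ∈ G ↔ ∀ p ∈ S, MvPolynomial.eval (fun ij => g.val ij.1 ij.2) p = 0

/-- The entry field of `Γ`: the subfield generated by all entries of all elements of `Γ`. -/
def entryField {n : ℕ} {k : Type*} [Field k]
    (Γ : Subgroup (Matrix.GeneralLinearGroup (Fin n) k)) : Subfield k :=
  Subfield.closure {x | ∃ γ ∈ Γ, ∃ i j, x = γ.val i j}

theorem entry_mem {n : ℕ} {k : Type*} [Field k]
    (Γ : Subgroup (Matrix.GeneralLinearGroup (Fin n) k)) (γ : Γ) (i j : Fin n) :
    γ.1.val i j ∈ entryField Γ :=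
  Subfield.subset_closure ⟨γ.1, γ.2, i, j, rfl⟩

/-- An element of `Γ`, as a matrix over the entry field of `Γ`. -/
def entryMatrix {n : ℕ} {k : Type*} [Field k]
    (Γ : Subgroup (Matrix.GeneralLinearGroup (Fin n) k)) (γ : Γ) :
    Matrix (Fin n) (Fin n) (entryField Γ) :=
  Matrix.of fun i j => ⟨γ.1.val i j, entry_mem Γ γ i j⟩

theorem entryMatrix_one {n : ℕ} {k : Type*} [Field k]
    (Γ : Subgroup (Matrix.GeneralLinearGroup (Fin n) k)) : entryMatrix Γ 1 = 1 := by
  ext i j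
  by_cases h : i = j <;> simp [entryMatrix, Matrix.one_apply, h]

theorem entryMatrix_mul {n : ℕ} {k : Type*} [Field k]
    (Γ : Subgroup (Matrix.GeneralLinearGroup (Fin n) k)) (γ δ : Γ) :
    entryMatrix Γ (γ * δ) = entryMatrix Γ γ * entryMatrix Γ δ := by
  ext i j
  simp [entryMatrix, Matrix.mul_apply]

/-- The inclusion of `Γ` in `GL_n(K)`, where `K` is the entry field of `Γ`. -/
def toEntryField {n : ℕ} {k : Type*} [Field k]
    (Γ : Subgroup (Matrix.GeneralLinearGroup (Fin n) k)) :
    Γ →* Matrix.GeneralLinearGroup (Fin n) (entryField Γ) where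
  toFun γ :=
    { val := entryMatrix Γ γ
      inv := entryMatrix Γ γ⁻¹
      val_inv := by rw [← entryMatrix_mul, mul_inv_cancel, entryMatrix_one]
      inv_val := by rw [← entryMatrix_mul, inv_mul_cancel, entryMatrix_one] }
  map_one' := Units.ext (entryMatrix_one Γ)
  map_mul' γ δ := Units.ext (entryMatrix_mul Γ γ δ)

/-- The map `γ ↦ γ^σ` that applies an embedding `σ` of the entry field of `Γ` to all entries. -/
def conjugate {n : ℕ} {k : Type*} [Field k]
    (Γ : Subgroup (Matrix.GeneralLinearGroup (Fin n) k)) (σ : entryField Γ →+* k) :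
    Γ →* Matrix.GeneralLinearGroup (Fin n) k :=
  (Matrix.GeneralLinearGroup.map σ).comp (toEntryField Γ)

end LinearDoubles

/-! Suppose that `Γ` acts faithfully on a finite-dimensional space `E` with a vector `v` and a
functional `f`, both fixed by `Λ`, such that `f(γv) = 0` exactly when `γ ∈ Λ`. Then `N = f(·)v` has
square zero and commutes with `Λ`, so conjugating the second copy of `Γ` by `t = 1 + XN` gives a
representation of the double over `ℝ[X]`. It is faithful by a ping-pong on leading coefficients
(`doubleHom_injective`). Finally `ℝ[X]` embeds in `ℂ`, and `ℂ`-linear groups are `ℝ`-linear.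

Such `E`, `v`, `f` come from a function `F` on `Γ` that lies in a finite-dimensional space stable
under right translations, is invariant under `Λ` on both sides and vanishes exactly on `Λ`
(`isLinearOver_double_of_isRepresentative`). For a compact group `L`, averaging over `L × L` and the
Hilbert basis theorem give a nonnegative biinvariant polynomial with zero locus `L`
(`exists_invariant_polynomial_zero_iff`). Separability gives a finite-index `H` with `Λ = H ∩ (Γ ∩
L)`, and `F` is the polynomial plus the indicator of the complement of `H`.

For the second statement, `L` is the closure of `(Γ ∩ G)^σ`. It meets `Γ^σ` only in `(Γ ∩ G)^σ`,
because `Γ ∩ G` is cut out in `Γ` by polynomials over the entry field (`comap_conjugate_closure`).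
-/

namespace LinearDoubles

/-! ### Leading coefficients and unipotent elements in `End(E)[X]`. -/

section LeadingCoefficient

open Polynomial

variable {k E : Type*} [Field k] [AddCommGroup E] [Module k E]

/-- The polynomial `M(X) v` with coefficients in `E` has degree at most `d`, and its coefficient
of degree `d` is `u`. -/
def HasTopCoeff (v : E) (M : (Module.End k E)[X]) (d : ℕ) (u : E) : Prop :=
  (∀ j, d < j → M.coeff j v = 0) ∧ M.coeff d v = u

theorem HasTopCoeff.C_mul {v u : E} {M : (Module.End k E)[X]} {d : ℕ}
    (h : HasTopCoeff v M d u) (g : Module.End k E) : HasTopCoeff v (C g * M) d (g u) := by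
  refine ⟨fun j hj => ?_, ?_⟩
  · rw [coeff_C_mul, Module.End.mul_apply, h.1 j hj, map_zero]
  · rw [coeff_C_mul, Module.End.mul_apply, h.2]

/-- The polynomial `1 + X N`, where `N` is the rank one endomorphism `x ↦ f(x) v`. -/
noncomputable def transvection (f : E →ₗ[k] k) (v : E) : (Module.End k E)[X] :=
  1 + X * C (f.smulRight v)

theorem HasTopCoeff.transvection_mul {v u : E} {M : (Module.End k E)[X]} {d : ℕ}
    (h : HasTopCoeff v M d u) (f : E →ₗ[k] k) (w : E) :
    HasTopCoeff v (transvection f w * M) (d + 1) (f u • w) := by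
  have key : ∀ j, (transvection f w * M).coeff (j + 1) v =
      M.coeff (j + 1) v + f (M.coeff j v) • w := by
    intro j
    rw [transvection, add_mul, one_mul, coeff_add, mul_assoc, coeff_X_mul, coeff_C_mul]
    rfl
  refine ⟨fun j hj => ?_, ?_⟩
  · obtain ⟨j, rfl⟩ : ∃ i, j = i + 1 := ⟨j - 1, by omega⟩
    rw [key, h.1 _ (by omega), h.1 _ (by omega)]
    simp
  · rw [key, h.1 _ (by omega), h.2, zero_add]

theorem transvection_mul_transvection_neg {f : E →ₗ[k] k} {v : E} (hf : f v = 0) :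
    transvection f v * transvection f (-v) = 1 := by
  have h0 : C (f.smulRight v) * C (f.smulRight (-v)) = (0 : (Module.End k E)[X]) := by
    rw [← C_mul, ← C_0]
    congr 1
    ext x
    simp [hf]
  have h1 : X * C (f.smulRight (-v)) + X * C (f.smulRight v) = (0 : (Module.End k E)[X]) := by
    rw [← mul_add, ← C_add, show f.smulRight (-v) + f.smulRight v = (0 : Module.End k E) by
      ext x; simp]
    simp
  have h2 : X * C (f.smulRight v) * (X * C (f.smulRight (-v))) = (0 : (Module.End k E)[X]) := by
    rw [mul_assoc, ← mul_assoc (C _) X, ← X_mul (p := C _), mul_assoc X, h0]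
    simp
  rw [transvection, transvection, add_mul, one_mul, mul_add, h2, mul_one, add_zero, add_assoc, h1,
    add_zero]

/-- `1 + X N` as a unit, where `N` is the nilpotent endomorphism `x ↦ f(x) v`. -/
noncomputable def transvectionUnit {f : E →ₗ[k] k} {v : E} (hf : f v = 0) :
    ((Module.End k E)[X])ˣ where
  val := transvection f v
  inv := transvection f (-v)
  val_inv := transvection_mul_transvection_neg hf
  inv_val := by
    simpa using transvection_mul_transvection_neg (f := f) (v := -v) (by simp [hf])

/-- This makes the two copies of `Γ` agree on `Λ`. -/
theorem transvection_comm {f : E →ₗ[k] k} {v : E} {g : Module.End k E} (hv : g v = v)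
    (hf : ∀ x, f (g x) = f x) : transvection f v * C g = C g * transvection f v := by
  have h : C (f.smulRight v) * C g = C g * C (f.smulRight v) := by
    rw [← C_mul, ← C_mul]
    congr 1
    ext x
    simp [hv, hf]
  rw [transvection, add_mul, mul_add, one_mul, mul_one, mul_assoc, h, ← mul_assoc,
    X_mul, mul_assoc]

end LeadingCoefficient

/-! ### The representation of the double and its faithfulness. -/

section Representation

open Polynomial Monoid

variable {k E Γ : Type*} [Field k] [AddCommGroup E] [Module k E] [Group Γ] {Λ : Subgroup Γ}

/-- The two homomorphisms `γ ↦ ρ(γ)` and `γ ↦ t ρ(γ) t⁻¹`, where `t = 1 + X N`. -/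
noncomputable def factorHom (ρ : Γ →* Module.End k E) {f : E →ₗ[k] k} {v : E} (hf : f v = 0) :
    Fin 2 → Γ →* (Module.End k E)[X] :=
  ![(C : _ →+* (Module.End k E)[X]).toMonoidHom.comp ρ,
    { toFun := fun γ => transvection f v * C (ρ γ) * transvection f (-v)
      map_one' := by
        rw [map_one, map_one, mul_one, transvection_mul_transvection_neg hf]
      map_mul' := fun a b => by
        rw [map_mul, map_mul]
        simp only [mul_assoc]
        congr 2
        rw [← mul_assoc (transvection f (-v)), show transvection f (-v) * transvection f v = 1
          from (transvectionUnit hf).inv_mul, one_mul] }]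

theorem factorHom_zero (ρ : Γ →* Module.End k E) {f : E →ₗ[k] k} {v : E} (hf : f v = 0) (γ : Γ) :
    factorHom ρ hf 0 γ = C (ρ γ) := rfl

theorem factorHom_one (ρ : Γ →* Module.End k E) {f : E →ₗ[k] k} {v : E} (hf : f v = 0) (γ : Γ) :
    factorHom ρ hf 1 γ = transvection f v * (C (ρ γ) * transvection f (-v)) :=
  mul_assoc _ _ _

/-- The representation of the double of `Γ` along `Λ` given by `γ ↦ ρ(γ)` on the first factor and
by `γ ↦ t ρ(γ) t⁻¹` on the second one. -/
noncomputable def doubleHom (ρ : Γ →* Module.End k E) {f : E →ₗ[k] k} {v : E} (hf : f v = 0)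
    (hΛv : ∀ l ∈ Λ, ρ l v = v) (hΛf : ∀ l ∈ Λ, ∀ x, f (ρ l x) = f x) :
    Double Λ →* (Module.End k E)[X] :=
  PushoutI.lift (factorHom ρ hf)
    (((C : _ →+* (Module.End k E)[X]).toMonoidHom.comp ρ).comp Λ.subtype) (by
      intro i
      ext1 l
      fin_cases i
      · rfl
      · change transvection f v * C (ρ l) * transvection f (-v) = C (ρ l)
        rw [transvection_comm (hΛv l l.2) (hΛf l l.2), mul_assoc,
          transvection_mul_transvection_neg hf, mul_one])

section

variable (ρ : Γ →* Module.End k E) {f : E →ₗ[k] k} {v : E} (hf : f v = 0)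
  (hΛv : ∀ l ∈ Λ, ρ l v = v) (hΛf : ∀ l ∈ Λ, ∀ x, f (ρ l x) = f x)

theorem doubleHom_of (i : Fin 2) (γ : Γ) :
    doubleHom ρ hf hΛv hΛf (PushoutI.of i γ) = factorHom ρ hf i γ :=
  PushoutI.lift_of _ _ _ _

theorem doubleHom_base (l : Λ) :
    doubleHom ρ hf hΛv hΛf (PushoutI.base _ l) = C (ρ l) :=
  PushoutI.lift_base _ _ _ _

theorem normalWord_of_fstIdx_eq_none
    {d : PushoutI.NormalWord.Transversal (fun _ : Fin 2 => Λ.subtype)}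
    (w : PushoutI.NormalWord d) (h : w.fstIdx = none) : w.prod = PushoutI.base _ w.head := by
  have : w.toWord = CoprodI.Word.empty := by
    ext1
    simpa [CoprodI.Word.fstIdx] using h
  rw [PushoutI.NormalWord.prod, this]
  simp

/-- The shape of the leading coefficient of the image of a normal word, according to the factor
that its first letter belongs to. -/
theorem hasTopCoeff_normalWord (hfv : ∀ γ, γ ∉ Λ → f (ρ γ v) ≠ 0)
    {d : PushoutI.NormalWord.Transversal (fun _ : Fin 2 => Λ.subtype)}
    (w : PushoutI.NormalWord d) :
    (w.fstIdx = some 0 → ∃ n u, f u ≠ 0 ∧ HasTopCoeff v (doubleHom ρ hf hΛv hΛf w.prod) n u) ∧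
    (w.fstIdx = some 1 → ∃ (n : ℕ) (c : k), n ≠ 0 ∧ c • v ≠ 0 ∧
      HasTopCoeff v (doubleHom ρ hf hΛv hΛf w.prod) n (c • v)) := by
  classical
  induction w using PushoutI.NormalWord.consRecOn with
  | empty => simp [PushoutI.NormalWord.empty, CoprodI.Word.fstIdx, CoprodI.Word.empty]
  | cons i γ w hmw _ hγ hw ih =>
    have hγ' : γ ∉ Λ := by simpa using hγ
    have hv0 : v ≠ 0 := by rintro rfl; exact hfv γ hγ' (by simp)
    have hidx : (PushoutI.NormalWord.cons γ w hmw hγ).fstIdx = some i := rfl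
    have hnone : w.fstIdx = none → HasTopCoeff v (doubleHom ρ hf hΛv hΛf w.prod) 0 v := by
      intro h
      rw [normalWord_of_fstIdx_eq_none w h, hw, map_one, map_one]
      exact ⟨fun j hj => by simp [coeff_one, hj.ne'], by simp⟩
    rw [hidx, PushoutI.NormalWord.prod_cons, map_mul, doubleHom_of]
    have hcase : ∀ x : Option (Fin 2), x = none ∨ x = some 0 ∨ x = some 1 := by decide
    -- A letter `ρ(γ)` with `γ ∉ Λ` turns a leading coefficient `c • v` into one outside `ker f`.
    -- From there `t⁻¹`, `ρ(γ)` and `t` produce a nonzero multiple of `v`, and the degree rises by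
    -- two.
    refine ⟨fun h => ?_, fun h => ?_⟩
    · obtain rfl : i = 0 := by simpa using h
      rw [factorHom_zero]
      rcases hcase w.fstIdx with h' | h' | h'
      · exact ⟨_, _, hfv γ hγ', (hnone h').C_mul _⟩
      · exact absurd h' hmw
      · obtain ⟨n, c, -, hc, hn⟩ := ih.2 h'
        exact ⟨_, _, by simp [(smul_ne_zero_iff.1 hc).1, hfv γ hγ'], hn.C_mul _⟩
    · obtain rfl : i = 1 := by simpa using h
      rw [factorHom_one, mul_assoc, mul_assoc]
      rcases hcase w.fstIdx with h' | h' | h'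
      -- For the last letter `t⁻¹` acts on `v` itself and fixes it, since `f v = 0`; only `t` raises
      -- the degree.
      · have h1 : HasTopCoeff v (transvection f (-v) * doubleHom ρ hf hΛv hΛf w.prod) 0 v := by
          rw [normalWord_of_fstIdx_eq_none w h', hw, map_one, map_one, mul_one]
          refine ⟨fun j hj => ?_, ?_⟩
          · obtain ⟨j, rfl⟩ : ∃ i, j = i + 1 := ⟨j - 1, by omega⟩
            simp [transvection, coeff_one, coeff_C]
            split_ifs <;> simp [hf]
          · simp [transvection]
        exact ⟨_, _, by simp, smul_ne_zero (hfv γ hγ') hv0, (h1.C_mul (ρ γ)).transvection_mul f v⟩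
      · obtain ⟨n, u, hu, hn⟩ := ih.1 h'
        exact ⟨_, _, by simp, smul_ne_zero (by simp [hu, hfv γ hγ']) hv0,
          ((hn.transvection_mul f (-v)).C_mul (ρ γ)).transvection_mul f v⟩
      · exact absurd h' hmw
  | base l w hw ih =>
    have hidx : (PushoutI.base (fun _ : Fin 2 => Λ.subtype) l • w).fstIdx = w.fstIdx := rfl
    rw [hidx, PushoutI.NormalWord.prod_smul, map_mul, doubleHom_base]
    refine ⟨fun h => ?_, fun h => ?_⟩
    · obtain ⟨n, u, hu, hn⟩ := ih.1 h
      exact ⟨_, _, by rwa [hΛf l l.2], hn.C_mul _⟩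
    · obtain ⟨n, c, hn0, hc, hn⟩ := ih.2 h
      refine ⟨n, c, hn0, hc, ?_⟩
      simpa [hΛv l l.2] using hn.C_mul (ρ l)

theorem doubleHom_injective (hρ : Function.Injective ρ) (hfv : ∀ γ, γ ∉ Λ → f (ρ γ v) ≠ 0) :
    Function.Injective (doubleHom ρ hf hΛv hΛf) := by
  classical
  rw [injective_iff_map_eq_one]
  intro x hx
  obtain ⟨d⟩ := PushoutI.NormalWord.transversal_nonempty (fun _ : Fin 2 => Λ.subtype)
    (fun _ => Λ.subtype_injective)
  obtain ⟨w, rfl⟩ := (PushoutI.NormalWord.equiv (d := d)).symm.surjective x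
  change doubleHom ρ hf hΛv hΛf w.prod = 1 at hx
  change w.prod = 1
  have key := hasTopCoeff_normalWord ρ hf hΛv hΛf hfv w
  rw [hx] at key
  have hcoeff : ∀ n u, HasTopCoeff v (1 : (Module.End k E)[X]) n u → n ≠ 0 → u = 0 := by
    intro n u h hn
    rw [← h.2, coeff_one, if_neg hn, LinearMap.zero_apply]
  have hcase : ∀ x : Option (Fin 2), x = none ∨ x = some 0 ∨ x = some 1 := by decide
  rcases hcase w.fstIdx with h | h | h
  · rw [normalWord_of_fstIdx_eq_none w h] at hx ⊢
    rw [doubleHom_base, ← C_1] at hx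
    have : (w.head : Γ) = 1 := hρ (by rw [map_one]; exact C_injective hx)
    rw [OneMemClass.coe_eq_one.1 this, map_one]
  · obtain ⟨n, u, hu, hn⟩ := key.1 h
    -- In degree zero the identity has top coefficient `v`, which lies in `ker f`.
    rcases eq_or_ne n 0 with rfl | hn0
    · exact absurd (by rw [← hn.2]; simpa using hf) hu
    · exact absurd (by rw [hcoeff n u hn hn0, map_zero]) hu
  · obtain ⟨n, c, hn0, hc, hn⟩ := key.2 h
    exact absurd (hcoeff n _ hn hn0) hc

end

end Representation

end LinearDoubles

/-! ### Change of scalars from `ℝ[X]` to `ℂ` to `ℝ`. -/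

namespace LinearDoubles

open Polynomial Cardinal

theorem IsLinearOver.of_injective_matrix {R : Type*} [CommRing R] {Γ : Type*} [Group Γ] {n : ℕ}
    (ρ : Γ →* Matrix (Fin n) (Fin n) R) (hρ : Function.Injective ρ) : IsLinearOver R Γ :=
  ⟨n, ρ.toHomUnits, fun _ _ h => hρ (congrArg Units.val h)⟩

theorem IsLinearOver.of_injective_end {k : Type*} [Field k] {Γ E : Type*} [Group Γ]
    [AddCommGroup E] [Module k E] [FiniteDimensional k E] (ρ : Γ →* Module.End k E)
    (hρ : Function.Injective ρ) : IsLinearOver k Γ :=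
  .of_injective_matrix
    ((MonoidHomClass.toMonoidHom (LinearMap.toMatrixAlgEquiv (Module.finBasis k E))).comp ρ)
    ((LinearMap.toMatrixAlgEquiv (Module.finBasis k E)).injective.comp hρ)

theorem IsLinearOver.map {R S : Type*} [CommRing R] [CommRing S] {Γ : Type*} [Group Γ]
    (h : IsLinearOver R Γ) (φ : R →+* S) (hφ : Function.Injective φ) : IsLinearOver S Γ := by
  obtain ⟨n, ρ, hρ⟩ := h
  refine .of_injective_matrix ((φ.mapMatrix (m := Fin n)).toMonoidHom.comp ((Units.coeHom _).comp ρ)) ?_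
  exact (Matrix.map_injective hφ).comp (Units.val_injective.comp hρ)

theorem IsLinearOver.real_of_complex {Γ : Type*} [Group Γ] (h : IsLinearOver ℂ Γ) :
    IsLinearOver ℝ Γ := by
  obtain ⟨n, ρ, hρ⟩ := h
  let restrict : Module.End ℂ (Fin n → ℂ) →* Module.End ℝ (Fin n → ℂ) :=
    { toFun := fun g => g.restrictScalars ℝ
      map_one' := rfl
      map_mul' := fun _ _ => rfl }
  refine .of_injective_end (restrict.comp ((MonoidHomClass.toMonoidHom
    (Matrix.toLinAlgEquiv' (R := ℂ) (n := Fin n))).comp ((Units.coeHom _).comp ρ))) ?_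
  exact (LinearMap.restrictScalars_injective ℝ).comp
    (Matrix.toLinAlgEquiv'.injective.comp (Units.val_injective.comp hρ))

/-- An algebraic closure of `ℝ(X)` has characteristic zero and the cardinality of the continuum,
hence is isomorphic to `ℂ` by Steinitz. -/
theorem exists_polynomial_real_embedding_complex :
    ∃ φ : ℝ[X] →+* ℂ, Function.Injective φ := by
  let F := FractionRing ℝ[X]
  let A := AlgebraicClosure F
  have hF : #F = 𝔠 := by
    rw [IsFractionRing.cardinalMk ℝ[X] F, Polynomial.cardinalMk_eq_max, mk_real,
      max_eq_left aleph0_le_continuum]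
  have hA : #A = 𝔠 := by
    refine le_antisymm ?_ ?_
    · refine (Algebra.IsAlgebraic.cardinalMk_le_max F A).trans ?_
      rw [hF, max_eq_left aleph0_le_continuum]
    · rw [← hF]
      exact mk_le_of_injective (algebraMap F A).injective
  have : CharZero F := charZero_of_injective_algebraMap (IsFractionRing.injective ℝ[X] F)
  have : CharZero A := charZero_of_injective_algebraMap (algebraMap F A).injective
  obtain ⟨e⟩ := IsAlgClosed.ringEquiv_of_equiv_of_charZero (K := A) (L := ℂ)
    (by rw [hA]; exact aleph0_lt_continuum)
    (Cardinal.eq.1 (by rw [hA, mk_complex]))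
  exact ⟨(e : A →+* ℂ).comp ((algebraMap F A).comp (algebraMap ℝ[X] F)),
    e.injective.comp ((algebraMap F A).injective.comp (IsFractionRing.injective ℝ[X] F))⟩

theorem IsLinearOver.of_injective_matrix_polynomial {R Γ : Type*} [CommRing R] [Group Γ] {n : ℕ}
    (ρ : Γ →* (Matrix (Fin n) (Fin n) R)[X]) (hρ : Function.Injective ρ) :
    IsLinearOver R[X] Γ := by
  let e : (Matrix (Fin n) (Fin n) R)[X] ≃+* Matrix (Fin n) (Fin n) R[X] :=
    matPolyEquiv.symm.toRingEquiv
  refine .of_injective_matrix (e.toRingHom.toMonoidHom.comp ρ) fun x y h => hρ (e.injective h)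

theorem IsLinearOver.of_injective_end_polynomial {Γ E : Type*} [Group Γ]
    [AddCommGroup E] [Module ℝ E] [FiniteDimensional ℝ E] (ρ : Γ →* (Module.End ℝ E)[X])
    (hρ : Function.Injective ρ) : IsLinearOver ℝ Γ := by
  obtain ⟨φ, hφ⟩ := exists_polynomial_real_embedding_complex
  let e : Module.End ℝ E ≃+* Matrix _ _ ℝ :=
    (LinearMap.toMatrixAlgEquiv (Module.finBasis ℝ E)).toRingEquiv
  have h : IsLinearOver ℝ[X] Γ :=
    .of_injective_matrix_polynomial ((Polynomial.mapRingHom e.toRingHom).toMonoidHom.comp ρ)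
      fun x y h => hρ (Polynomial.map_injective e.toRingHom e.injective h)
  exact (h.map φ hφ).real_of_complex

/-! ### Representative functions. -/

/-- A function on a group is representative if it lies in a finite-dimensional space of functions
that is stable under right translations. -/
def IsRepresentative {Γ : Type*} [Group Γ] (F : Γ → ℝ) : Prop :=
  ∃ W : Submodule ℝ (Γ → ℝ), W.FG ∧ F ∈ W ∧ ∀ φ ∈ W, ∀ g : Γ, (fun x => φ (x * g)) ∈ W

section Representative

variable {Γ : Type*} [Group Γ]

/-- Right translation of functions. -/
def rightTranslation (g : Γ) : (Γ → ℝ) →ₐ[ℝ] (Γ → ℝ) where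
  toFun φ x := φ (x * g)
  map_one' := rfl
  map_mul' _ _ := rfl
  map_zero' := rfl
  map_add' _ _ := rfl
  commutes' _ := rfl

@[simp]
theorem rightTranslation_apply (g : Γ) (φ : Γ → ℝ) (x : Γ) :
    rightTranslation g φ x = φ (x * g) := rfl

theorem isRepresentative_iff {F : Γ → ℝ} : IsRepresentative F ↔ ∃ W : Submodule ℝ (Γ → ℝ),
    W.FG ∧ F ∈ W ∧ ∀ g : Γ, W.map (rightTranslation g).toLinearMap ≤ W := by
  simp only [Submodule.map_le_iff_le_comap]
  exact exists_congr fun W => and_congr_right fun _ => and_congr_right fun _ =>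
    ⟨fun h g φ hφ => h φ hφ g, fun h φ hφ g => h g hφ⟩

theorem IsRepresentative.add {F₁ F₂ : Γ → ℝ} (h₁ : IsRepresentative F₁)
    (h₂ : IsRepresentative F₂) : IsRepresentative (F₁ + F₂) := by
  rw [isRepresentative_iff] at *
  obtain ⟨W₁, hW₁, hF₁, hg₁⟩ := h₁
  obtain ⟨W₂, hW₂, hF₂, hg₂⟩ := h₂
  refine ⟨W₁ ⊔ W₂, hW₁.sup hW₂, Submodule.add_mem_sup hF₁ hF₂, fun g => ?_⟩
  rw [Submodule.map_sup]
  exact sup_le_sup (hg₁ g) (hg₂ g)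

theorem IsRepresentative.mul {F₁ F₂ : Γ → ℝ} (h₁ : IsRepresentative F₁)
    (h₂ : IsRepresentative F₂) : IsRepresentative (F₁ * F₂) := by
  rw [isRepresentative_iff] at *
  obtain ⟨W₁, hW₁, hF₁, hg₁⟩ := h₁
  obtain ⟨W₂, hW₂, hF₂, hg₂⟩ := h₂
  refine ⟨W₁ * W₂, hW₁.mul hW₂, Submodule.mul_mem_mul hF₁ hF₂, fun g => ?_⟩
  rw [Submodule.map_mul]
  exact mul_le_mul' (hg₁ g) (hg₂ g)

theorem isRepresentative_const (c : ℝ) : IsRepresentative (fun _ : Γ => c) := by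
  refine ⟨Submodule.span ℝ {1}, Submodule.fg_span_singleton _, ?_, ?_⟩
  · exact Submodule.mem_span_singleton.2 ⟨c, by ext; simp⟩
  · rintro φ hφ g
    obtain ⟨a, rfl⟩ := Submodule.mem_span_singleton.1 hφ
    exact Submodule.mem_span_singleton.2 ⟨a, by ext; simp⟩

theorem isRepresentative_entry {m : ℕ} (ρ : Γ →* Matrix (Fin m) (Fin m) ℝ) (i j : Fin m) :
    IsRepresentative (fun x => ρ x i j) := by
  rw [isRepresentative_iff]
  refine ⟨Submodule.span ℝ (Set.range fun (j : Fin m) (x : Γ) => ρ x i j),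
    Submodule.fg_span (Set.finite_range _), Submodule.subset_span ⟨j, rfl⟩, fun g => ?_⟩
  rw [Submodule.map_span_le]
  rintro _ ⟨j, rfl⟩
  have : (rightTranslation g).toLinearMap (fun x => ρ x i j) =
      ∑ l, ρ g l j • fun x => ρ x i l := by
    ext x
    simp [Matrix.mul_apply, mul_comm]
  rw [this]
  exact Submodule.sum_mem _ fun l _ => Submodule.smul_mem _ _ (Submodule.subset_span ⟨l, rfl⟩)

theorem isRepresentative_eval {m : ℕ} (ρ : Γ →* Matrix (Fin m) (Fin m) ℝ)
    (p : MvPolynomial (Fin m × Fin m) ℝ) :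
    IsRepresentative (fun x => MvPolynomial.eval (fun ij => ρ x ij.1 ij.2) p) := by
  induction p using MvPolynomial.induction_on with
  | C a => simpa using isRepresentative_const a
  | add p q hp hq => simpa [Pi.add_def] using hp.add hq
  | mul_X p ij hp => simpa [Pi.mul_def] using hp.mul (isRepresentative_entry ρ ij.1 ij.2)

open Classical in
theorem isRepresentative_indicator_compl (H : Subgroup Γ) [H.FiniteIndex] :
    IsRepresentative (fun x => if x ∈ H then 0 else 1) := by
  rw [isRepresentative_iff]
  -- The inverse turns right translation by `g` into the action of `g⁻¹` on left cosets.
  let e : (Γ ⧸ H → ℝ) →ₗ[ℝ] (Γ → ℝ) := LinearMap.funLeft ℝ ℝ fun x => ((x⁻¹ : Γ) : Γ ⧸ H)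
  refine ⟨LinearMap.range e, ?_, ⟨fun c => if c = ((1 : Γ) : Γ ⧸ H) then 0 else 1, ?_⟩,
    fun g => ?_⟩
  · rw [LinearMap.range_eq_map]
    exact Submodule.FG.map e Module.Finite.fg_top
  · ext x
    simp [e, LinearMap.funLeft, QuotientGroup.eq]
  · rintro _ ⟨_, ⟨ψ, rfl⟩, rfl⟩
    refine ⟨fun c => ψ (g⁻¹ • c), ?_⟩
    ext x
    simp [e, LinearMap.funLeft]

/-- The double of `Γ` along `Λ` is linear if `Γ` is linear and `Λ` is the zero locus of a
representative function that is invariant under translations by `Λ` from both sides. -/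
theorem isLinearOver_double_of_isRepresentative {Λ : Subgroup Γ} {m : ℕ}
    (ρ : Γ →* Matrix (Fin m) (Fin m) ℝ) (hρ : Function.Injective ρ) {F : Γ → ℝ}
    (hF : IsRepresentative F) (hl : ∀ l ∈ Λ, ∀ x, F (l * x) = F x)
    (hr : ∀ l ∈ Λ, ∀ x, F (x * l) = F x) (h0 : ∀ x, F x = 0 ↔ x ∈ Λ) :
    IsLinearOver ℝ (Double Λ) := by
  obtain ⟨W, hW, hFW, hWg⟩ := hF
  -- Left invariance under `Λ` survives right translation, and makes evaluation at `1` a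
  -- `Λ`-invariant functional.
  let U : Submodule ℝ (Γ → ℝ) := W ⊓
    { carrier := {φ | ∀ l ∈ Λ, ∀ x, φ (l * x) = φ x}
      add_mem' := fun ha hb l hl x => by simp [ha l hl x, hb l hl x]
      zero_mem' := fun l hl x => rfl
      smul_mem' := fun c φ hφ l hl x => by simp [hφ l hl x] }
  have : FiniteDimensional ℝ W := Module.Finite.of_fg hW
  have : FiniteDimensional ℝ U := Submodule.finiteDimensional_of_le inf_le_left
  have hU : ∀ g, ∀ φ ∈ U, (rightTranslation g).toLinearMap φ ∈ U := by
    intro g φ hφ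
    refine ⟨hWg φ hφ.1 g, fun l hl x => ?_⟩
    change φ (l * x * g) = φ (x * g)
    rw [mul_assoc]
    exact hφ.2 l hl _
  -- The summand `ρ` only serves to make `τ` faithful.
  let τ : Γ →* Module.End ℝ (U × (Fin m → ℝ)) :=
    { toFun := fun g => ((rightTranslation g).toLinearMap.restrict (hU g)).prodMap
        (Matrix.toLin' (ρ g))
      map_one' := by
        refine LinearMap.ext fun x => Prod.ext (Subtype.ext (funext fun y => ?_)) ?_
        · simp
        · simp
      map_mul' := fun a b => by
        refine LinearMap.ext fun x => Prod.ext (Subtype.ext (funext fun y => ?_)) ?_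
        · simp [mul_assoc]
        · simp }
  have hτ : Function.Injective τ := by
    intro a b hab
    refine hρ (Matrix.toLin'.injective (LinearMap.ext fun y => ?_))
    exact congrArg Prod.snd (LinearMap.congr_fun hab (0, y))
  let v : U × (Fin m → ℝ) := (⟨F, hFW, hl⟩, 0)
  let f : U × (Fin m → ℝ) →ₗ[ℝ] ℝ :=
    (LinearMap.proj (1 : Γ)).comp (U.subtype.comp (LinearMap.fst ℝ _ _))
  have hfv : ∀ g, f (τ g v) = F g := fun g => by
    change F (1 * g) = F g
    rw [one_mul]
  have hv : f v = 0 := (h0 1).2 Λ.one_mem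
  have hΛv : ∀ l ∈ Λ, τ l v = v := fun l hl => by
    refine Prod.ext (Subtype.ext (funext fun y => ?_)) ?_
    · exact hr l hl y
    · simp [τ, v]
  have hΛf : ∀ l ∈ Λ, ∀ x, f (τ l x) = f x := fun l hl x => by
    have := x.1.2.2 l hl 1
    rw [mul_one] at this
    change x.1.1 (1 * l) = x.1.1 1
    rwa [one_mul]
  exact .of_injective_end_polynomial (doubleHom τ hv hΛv hΛf)
    (doubleHom_injective τ hv hΛv hΛf hτ fun γ hγ => by rwa [hfv, Ne, h0])

end Representative

end LinearDoubles

/-! ### Biinvariant polynomials of a compact group. -/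

namespace LinearDoubles

open MeasureTheory

/-- Evaluation of a polynomial at the entries of a matrix. -/
noncomputable abbrev evalMatrix {m : ℕ} {k : Type*} [CommSemiring k]
    (x : Matrix (Fin m) (Fin m) k) : MvPolynomial (Fin m × Fin m) k →+* k :=
  MvPolynomial.eval fun ij => x ij.1 ij.2

theorem continuous_evalMatrix {m : ℕ} {k : Type*} [CommSemiring k] [TopologicalSpace k]
    [IsTopologicalSemiring k] (p : MvPolynomial (Fin m × Fin m) k) :
    Continuous fun x : Matrix (Fin m) (Fin m) k => evalMatrix x p :=
  (MvPolynomial.continuous_eval p).comp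
    (continuous_pi fun ij => continuous_id.matrix_elem ij.1 ij.2)

/-- Stone–Weierstrass on `A ∪ B`, within `1/3` of a Urysohn function that is `0` on `A` and `1` on
`B`. -/
theorem exists_polynomial_separating {m : ℕ} {A B : Set (Matrix (Fin m) (Fin m) ℝ)}
    (hA : IsCompact A) (hB : IsCompact B) (hAB : Disjoint A B) :
    ∃ p : MvPolynomial (Fin m × Fin m) ℝ,
      (∀ x ∈ A, evalMatrix x p ≤ 1 / 3) ∧ ∀ x ∈ B, 2 / 3 ≤ evalMatrix x p := by
  have : LocallyCompactSpace (Matrix (Fin m) (Fin m) ℝ) :=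
    inferInstanceAs (LocallyCompactSpace (Fin m → Fin m → ℝ))
  obtain ⟨u, hu0, hu1, -⟩ := exists_continuous_zero_one_of_isCompact hA hB.isClosed hAB
  let coord : Fin m × Fin m → C(Matrix (Fin m) (Fin m) ℝ, ℝ) := fun ij =>
    ⟨fun x => x ij.1 ij.2, continuous_id.matrix_elem ij.1 ij.2⟩
  have hcoord : ∀ p x, MvPolynomial.aeval (R := ℝ) coord p x = evalMatrix x p := by
    intro p x
    induction p using MvPolynomial.induction_on with
    | C a => simp
    | add p q hp hq => simp [hp, hq]
    | mul_X p ij hp => simp [hp, coord]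
  obtain ⟨_, ⟨p, rfl⟩, hp⟩ :=
    ContinuousMap.exists_mem_subalgebra_near_continuous_of_isCompact_of_separatesPoints
      (A := (MvPolynomial.aeval (R := ℝ) coord).range) (by
        intro x y hxy
        obtain ⟨i, j, hij⟩ : ∃ i j, x i j ≠ y i j := by
          by_contra! h
          exact hxy (Matrix.ext h)
        exact ⟨_, ⟨coord (i, j), ⟨MvPolynomial.X (i, j), by simp⟩, rfl⟩, hij⟩)
      u (hA.union hB) (ε := 1 / 3) (by norm_num)
  refine ⟨p, fun x hx => ?_, fun x hx => ?_⟩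
  · have h1 := hp x (Or.inl hx)
    have h2 : u x = 0 := hu0 hx
    simp only [AlgHom.toRingHom_eq_coe, RingHom.coe_coe, hcoord, h2] at h1
    have := (abs_lt.1 h1).2
    linarith
  · have h1 := hp x (Or.inr hx)
    have h2 : u x = 1 := hu1 hx
    simp only [AlgHom.toRingHom_eq_coe, RingHom.coe_coe, hcoord, h2] at h1
    have := (abs_lt.1 h1).1
    linarith

/-- The average of a polynomial over a compact family of two-sided translations is a polynomial. -/
theorem exists_polynomial_average {m : ℕ} {Q : Type*} [TopologicalSpace Q] [CompactSpace Q]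
    [MeasurableSpace Q] [BorelSpace Q] (μ : Measure Q) [IsFiniteMeasure μ]
    {a b : Q → Matrix (Fin m) (Fin m) ℝ} (ha : Continuous a) (hb : Continuous b)
    (p : MvPolynomial (Fin m × Fin m) ℝ) :
    ∃ P : MvPolynomial (Fin m × Fin m) ℝ, ∀ x, evalMatrix x P =
      ∫ q, evalMatrix (a q * x * b q) p ∂μ := by
  let A : Fin m → Fin m → C(Q, ℝ) := fun i j => ⟨fun q => a q i j, ha.matrix_elem i j⟩
  let B : Fin m → Fin m → C(Q, ℝ) := fun i j => ⟨fun q => b q i j, hb.matrix_elem i j⟩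
  -- `p(a X b)` for a generic matrix `X`, with coefficients continuous on `Q`; the average
  -- integrates these coefficients.
  let P' : MvPolynomial (Fin m × Fin m) C(Q, ℝ) := MvPolynomial.aeval (R := ℝ)
    (fun ij : Fin m × Fin m => ∑ l, (∑ k, MvPolynomial.C (A ij.1 k) * MvPolynomial.X (k, l)) *
      MvPolynomial.C (B l ij.2)) p
  let ev : Q → C(Q, ℝ) →+* ℝ := fun q => (ContinuousMap.evalAlgHom ℝ ℝ q : C(Q, ℝ) →ₐ[ℝ] ℝ)
  have hev : ∀ q c, ev q c = c q := fun _ _ => rfl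
  have hP' : ∀ q x, MvPolynomial.eval₂ (ev q) (fun ij => x ij.1 ij.2) P' =
      evalMatrix (a q * x * b q) p := by
    intro q x
    simp only [P']
    induction p using MvPolynomial.induction_on with
    | C a => simp [MvPolynomial.algebraMap_apply, hev]
    | add p q hp hq => simp [hp, hq]
    | mul_X p ij hp => simp [hp, Matrix.mul_apply, hev, A, B, MvPolynomial.eval₂_sum]
  have hint : ∀ c : C(Q, ℝ), Integrable (fun q => c q) μ := fun c =>
    c.continuous.integrable_of_hasCompactSupport (HasCompactSupport.of_compactSpace _)
  refine ⟨∑ s ∈ P'.support, MvPolynomial.monomial s (∫ q, (P'.coeff s) q ∂μ), fun x => ?_⟩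
  simp only [← hP', MvPolynomial.eval₂_eq, hev, map_sum, MvPolynomial.eval_monomial]
  rw [integral_finsetSum _ fun s _ => (hint _).mul_const _]
  refine Finset.sum_congr rfl fun s _ => ?_
  rw [integral_mul_const, Finsupp.prod]

/-- A compact subgroup `L` of `GL_m(ℝ)` is separated from every element outside of it by a
polynomial that is invariant under translations by `L` from both sides. -/
theorem exists_invariant_polynomial {m : ℕ}
    (L : Subgroup (Matrix.GeneralLinearGroup (Fin m) ℝ))
    (hL : IsCompact (L : Set (Matrix.GeneralLinearGroup (Fin m) ℝ)))
    {g : Matrix.GeneralLinearGroup (Fin m) ℝ} (hg : g ∉ L) :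
    ∃ p : MvPolynomial (Fin m × Fin m) ℝ,
      (∀ l ∈ L, ∀ l' ∈ L, ∀ x, evalMatrix (l.val * x * l'.val) p = evalMatrix x p) ∧
      evalMatrix 1 p = 0 ∧ evalMatrix g.val p ≠ 0 := by
  have : CompactSpace L := isCompact_iff_compactSpace.1 hL
  let Q := L × L
  let : MeasurableSpace Q := borel Q
  have : BorelSpace Q := ⟨rfl⟩
  let μ : Measure Q := Measure.haarMeasure ⊤
  have hμ : IsProbabilityMeasure μ := ⟨Measure.haarMeasure_self⟩
  -- With the inverse here, replacing `x` by `l x l'` is left translation of `q` by `(l⁻¹, l')`,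
  -- which preserves Haar measure.
  let a : Q → Matrix (Fin m) (Fin m) ℝ := fun q => ((q.1⁻¹ : L) : Matrix.GeneralLinearGroup _ ℝ).val
  let b : Q → Matrix (Fin m) (Fin m) ℝ := fun q => (q.2 : Matrix.GeneralLinearGroup _ ℝ).val
  have ha : Continuous a :=
    Units.continuous_val.comp (continuous_subtype_val.comp continuous_fst.inv)
  have hb : Continuous b := Units.continuous_val.comp (continuous_subtype_val.comp continuous_snd)
  have hcont : ∀ x : Matrix (Fin m) (Fin m) ℝ, Continuous fun q => a q * x * b q := fun x =>
    (ha.matrix_mul continuous_const).matrix_mul hb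
  have hcompact : ∀ x : Matrix (Fin m) (Fin m) ℝ, IsCompact (Set.range fun q => a q * x * b q) :=
    fun x => isCompact_range (hcont x)
  -- The sets `L` and `LgL` are disjoint because `g ∉ L`; the bounds on them survive averaging.
  obtain ⟨p, hp1, hp2⟩ := exists_polynomial_separating (hcompact 1) (hcompact g.val) (by
    rw [Set.disjoint_left]
    rintro _ ⟨q, rfl⟩ ⟨r, hr⟩
    have hr' : r.1.1⁻¹ * g * r.2.1 = q.1.1⁻¹ * q.2.1 :=
      Units.ext (by simpa [a, b] using hr)
    apply hg
    have : g = r.1.1 * (q.1.1⁻¹ * q.2.1) * r.2.1⁻¹ := by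
      rw [← hr']
      simp [mul_assoc]
    rw [this]
    exact L.mul_mem (L.mul_mem r.1.2 (L.mul_mem (L.inv_mem q.1.2) q.2.2)) (L.inv_mem r.2.2))
  obtain ⟨P, hP⟩ := exists_polynomial_average μ ha hb p
  have hint : ∀ x, Integrable (fun q => evalMatrix (a q * x * b q) p) μ := fun x =>
    ((continuous_evalMatrix p).comp (hcont x)).integrable_of_hasCompactSupport
      (HasCompactSupport.of_compactSpace _)
  have hP1 : evalMatrix 1 P ≤ 1 / 3 := by
    rw [hP]
    refine (integral_mono (hint 1) (integrable_const (1 / 3)) fun q => hp1 _ ⟨q, rfl⟩).trans ?_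
    simp
  have hPg : 2 / 3 ≤ evalMatrix g.val P := by
    rw [hP]
    refine le_trans ?_ (integral_mono (integrable_const (2 / 3)) (hint g.val)
      fun q => hp2 _ ⟨q, rfl⟩)
    simp
  refine ⟨P - MvPolynomial.C (evalMatrix 1 P), fun l hl l' hl' x => ?_, by simp, ?_⟩
  · simp only [map_sub, MvPolynomial.eval_C, sub_left_inj]
    have hr := integral_mul_left_eq_self (μ := μ) (fun q => evalMatrix (a q * x * b q) p)
      ((⟨l, hl⟩⁻¹, ⟨l', hl'⟩) : Q)
    rw [hP, hP, ← hr]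
    refine integral_congr_ae (.of_forall fun q => ?_)
    have ha' : a ((⟨l, hl⟩⁻¹, ⟨l', hl'⟩) * q) = a q * l.val := by
      change ((⟨l, hl⟩⁻¹ * q.1)⁻¹ : L).1.val = _
      rw [mul_inv_rev, inv_inv]
      rfl
    have hb' : b ((⟨l, hl⟩⁻¹, ⟨l', hl'⟩) * q) = l'.val * b q := rfl
    simp only [ha', hb', mul_assoc]
  · rw [map_sub, MvPolynomial.eval_C]
    intro h
    linarith

/-- A compact subgroup of `GL_m(ℝ)` is the zero locus of a single polynomial that is invariant
under its translations from both sides and nonnegative. -/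
theorem exists_invariant_polynomial_zero_iff {m : ℕ}
    (L : Subgroup (Matrix.GeneralLinearGroup (Fin m) ℝ))
    (hL : IsCompact (L : Set (Matrix.GeneralLinearGroup (Fin m) ℝ))) :
    ∃ p : MvPolynomial (Fin m × Fin m) ℝ,
      (∀ l ∈ L, ∀ l' ∈ L, ∀ x, evalMatrix (l.val * x * l'.val) p = evalMatrix x p) ∧
      (∀ x, 0 ≤ evalMatrix x p) ∧
      ∀ g : Matrix.GeneralLinearGroup (Fin m) ℝ, evalMatrix g.val p = 0 ↔ g ∈ L := by
  let S : Set (MvPolynomial (Fin m × Fin m) ℝ) := {p |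
    (∀ l ∈ L, ∀ l' ∈ L, ∀ x, evalMatrix (l.val * x * l'.val) p = evalMatrix x p) ∧
      evalMatrix 1 p = 0}
  -- The finitely many generators are taken inside `S`, so each is invariant; the ideal they span
  -- need not be.
  obtain ⟨T, hTS, hT⟩ := (Submodule.fg_span_iff_fg_span_finset_subset S).1
    (IsNoetherian.noetherian (Ideal.span S))
  have hnonneg : ∀ x p, 0 ≤ evalMatrix (m := m) (k := ℝ) x (p ^ 2) := fun x p => by
    rw [map_pow]; positivity
  refine ⟨∑ p ∈ T, p ^ 2, fun l hl l' hl' x => ?_, fun x => ?_, fun g => ⟨fun h => ?_, fun h => ?_⟩⟩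
  · rw [map_sum, map_sum]
    refine Finset.sum_congr rfl fun p hp => ?_
    rw [map_pow, map_pow, (hTS hp).1 l hl l' hl' x]
  · rw [map_sum]
    exact Finset.sum_nonneg fun p _ => hnonneg x p
  · by_contra hg
    obtain ⟨p, hp, hp1, hpg⟩ := exists_invariant_polynomial L hL hg
    rw [map_sum, Finset.sum_eq_zero_iff_of_nonneg fun p _ => hnonneg _ p] at h
    have hle : Ideal.span S ≤ RingHom.ker (evalMatrix g.val) := by
      change Submodule.span _ S ≤ _
      rw [hT]
      refine Ideal.span_le.2 fun q hq => ?_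
      exact pow_eq_zero_iff two_ne_zero |>.1 ((map_pow _ _ _).symm.trans (h q hq))
    exact hpg (hle (Ideal.subset_span ⟨hp, hp1⟩))
  · rw [map_sum]
    refine Finset.sum_eq_zero fun p hp => ?_
    have := (hTS hp).1 g h 1 L.one_mem 1
    rw [Units.val_one, mul_one, mul_one, (hTS hp).2] at this
    rw [map_pow, this, zero_pow two_ne_zero]

end LinearDoubles

/-! ### Separability, and doubles along relatively compact subgroups. -/

namespace LinearDoubles

/-- If `Λ` is separable and has finite index in `D`, then `Λ` is the intersection of `D` with a
finite-index subgroup. -/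
theorem IsSeparableSubgroup.exists_finiteIndex {Γ : Type*} [Group Γ] {Λ D : Subgroup Γ}
    (hsep : IsSeparableSubgroup Λ) (hfin : Λ.IsFiniteRelIndex D) :
    ∃ H : Subgroup Γ, H.FiniteIndex ∧ Λ ≤ H ∧ H ⊓ D ≤ Λ := by
  obtain ⟨S, hS, rfl⟩ := hsep
  have : ((sInf S).subgroupOf D).FiniteIndex := ⟨hfin.relIndex_ne_zero⟩
  -- One finite-index subgroup for each of the finitely many cosets excludes its representative
  -- unless that lies in `Λ`.
  have h : ∀ c : D ⧸ (sInf S).subgroupOf D, ∃ H : Subgroup Γ, H.FiniteIndex ∧ sInf S ≤ H ∧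
      (((c.out : D) : Γ) ∈ H → ((c.out : D) : Γ) ∈ sInf S) := by
    intro c
    by_cases hc : ((c.out : D) : Γ) ∈ sInf S
    · exact ⟨⊤, inferInstance, le_top, fun _ => hc⟩
    · have hc' := hc
      rw [Subgroup.mem_sInf] at hc'
      push Not at hc'
      obtain ⟨H, hH, hcH⟩ := hc'
      exact ⟨H, hS H hH, sInf_le hH, fun h => absurd h hcH⟩
  choose H hHfin hHle hH using h
  refine ⟨⨅ c, H c, Subgroup.finiteIndex_iInf hHfin, le_iInf hHle, fun x hx => ?_⟩
  let c : D ⧸ (sInf S).subgroupOf D := ((⟨x, hx.2⟩ : D) : D ⧸ (sInf S).subgroupOf D)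
  have hc : (c.out : Γ)⁻¹ * x ∈ sInf S := by
    have : (c.out : D ⧸ (sInf S).subgroupOf D) = ((⟨x, hx.2⟩ : D) : D ⧸ (sInf S).subgroupOf D) :=
      QuotientGroup.out_eq' c
    have h := QuotientGroup.eq.1 this
    exact h
  have hxc : x ∈ H c := Subgroup.mem_iInf.1 hx.1 c
  have hout : (c.out : Γ) ∈ H c := by
    have := (H c).mul_mem hxc ((H c).inv_mem (hHle c hc))
    simpa using this
  have := (sInf S).mul_mem (hH c hout) hc
  simpa using this

/-- The double of a linear group `Γ` along a separable subgroup of finite index in the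
intersection of `Γ` with a compact group is linear. -/
theorem isLinearOver_double_of_isCompact {Γ : Type*} [Group Γ] {Λ : Subgroup Γ} {m : ℕ}
    (ρ : Γ →* Matrix.GeneralLinearGroup (Fin m) ℝ) (hρ : Function.Injective ρ)
    (L : Subgroup (Matrix.GeneralLinearGroup (Fin m) ℝ))
    (hL : IsCompact (L : Set (Matrix.GeneralLinearGroup (Fin m) ℝ)))
    (hΛ : Λ ≤ L.comap ρ) (hfin : Λ.IsFiniteRelIndex (L.comap ρ))
    (hsep : IsSeparableSubgroup Λ) : IsLinearOver ℝ (Double Λ) := by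
  classical
  obtain ⟨H, hH, hΛH, hHΛ⟩ := hsep.exists_finiteIndex hfin
  obtain ⟨p, hp, hp0, hpL⟩ := exists_invariant_polynomial_zero_iff L hL
  let ρ' : Γ →* Matrix (Fin m) (Fin m) ℝ := (Units.coeHom _).comp ρ
  have hρ' : Function.Injective ρ' := Units.val_injective.comp hρ
  have hl : ∀ l ∈ Λ, ∀ x, evalMatrix (ρ' (l * x)) p = evalMatrix (ρ' x) p := fun l hl x => by
    simpa [ρ'] using hp _ (hΛ hl) 1 L.one_mem (ρ' x)
  have hr : ∀ l ∈ Λ, ∀ x, evalMatrix (ρ' (x * l)) p = evalMatrix (ρ' x) p := fun l hl x => by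
    simpa [ρ'] using hp 1 L.one_mem _ (hΛ hl) (ρ' x)
  refine isLinearOver_double_of_isRepresentative ρ' hρ'
    ((isRepresentative_eval ρ' p).add (isRepresentative_indicator_compl H))
    (fun l hlΛ x => ?_) (fun l hlΛ x => ?_) fun x => ?_
  · simp only [Pi.add_apply]
    rw [hl l hlΛ x]
    simp only [H.mul_mem_cancel_left (hΛH hlΛ)]
  · simp only [Pi.add_apply]
    rw [hr l hlΛ x]
    simp only [H.mul_mem_cancel_right (hΛH hlΛ)]
  · simp only [Pi.add_apply]
    -- Both terms are nonnegative, so the zero set is the preimage of `L` intersected with `H`.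
    rw [add_eq_zero_iff_of_nonneg (hp0 _) (by split_ifs <;> norm_num)]
    change evalMatrix (ρ x).val p = 0 ∧ _ ↔ _
    rw [hpL]
    simp only [ite_eq_left_iff, one_ne_zero, imp_false, not_not]
    exact ⟨fun h => hHΛ ⟨h.2, h.1⟩, fun h => ⟨hΛ h, hΛH h⟩⟩

/-- The double of a linear group along a subgroup that becomes relatively compact in some faithful
linear representation over `ℝ`, in a form that does not refer to a basis. -/
theorem isLinearOver_double_of_isCompact_end {Γ E : Type*} [Group Γ] [AddCommGroup E] [Module ℝ E]
    [FiniteDimensional ℝ E] {Λ : Subgroup Γ} {G : Type*} [Group G] [TopologicalSpace G]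
    [ContinuousInv G] (ρ : Γ →* G) (hρ : Function.Injective ρ) (L : Subgroup G) (hL : IsCompact (L : Set G))
    (τ : G →* Module.End ℝ E) (hτ : Function.Injective τ)
    (hcont : ∀ f : Module.End ℝ E →ₗ[ℝ] ℝ, Continuous fun g => f (τ g))
    (hΛ : Λ ≤ L.comap ρ) (hfin : Λ.IsFiniteRelIndex (L.comap ρ))
    (hsep : IsSeparableSubgroup Λ) : IsLinearOver ℝ (Double Λ) := by
  let b := Module.finBasis ℝ E
  let e : Module.End ℝ E ≃+* Matrix _ _ ℝ := (LinearMap.toMatrixAlgEquiv b).toRingEquiv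
  let θ₀ : G →* Matrix (Fin (Module.finrank ℝ E)) (Fin (Module.finrank ℝ E)) ℝ :=
    e.toRingHom.toMonoidHom.comp τ
  have hθ₀ : Continuous θ₀ := by
    refine continuous_matrix fun i j => ?_
    -- Matrix entries are linear functionals, so no topology on `End(E)` has to be chosen.
    exact hcont ((Matrix.entryLinearMap ℝ ℝ i j).comp (LinearMap.toMatrixAlgEquiv b).toLinearMap)
  let θ := θ₀.toHomUnits
  have hθ : Continuous θ := Units.continuous_iff.2 ⟨hθ₀, hθ₀.comp continuous_inv⟩
  have hθinj : Function.Injective θ := fun x y h =>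
    hτ (e.injective (congrArg Units.val h))
  have hcomap : (L.map θ).comap (θ.comp ρ) = L.comap ρ := by
    rw [← Subgroup.comap_comap, Subgroup.comap_map_eq_self_of_injective hθinj]
  refine isLinearOver_double_of_isCompact (θ.comp ρ) (hθinj.comp hρ) (L.map θ) ?_
    (by rwa [hcomap]) (by rwa [hcomap]) hsep
  rw [Subgroup.coe_map]
  exact hL.image hθ

end LinearDoubles

/-! ### The two cases: compact subgroups of `GL(V)` and Galois conjugates. -/

namespace LinearDoubles

theorem isFiniteRelIndex_subgroupOf {G : Type*} [Group G] {Γ D Λ : Subgroup G}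
    (h : Λ.IsFiniteRelIndex (Γ ⊓ D)) : (Λ.subgroupOf Γ).IsFiniteRelIndex (D.subgroupOf Γ) := by
  refine ⟨?_⟩
  rw [← Subgroup.inf_subgroupOf_left D Γ, Subgroup.relIndex_subgroupOf inf_le_left]
  exact h.relIndex_ne_zero

theorem isLinearOver_double_of_isCompactSubgroup {V : Type*} [AddCommGroup V] [Module ℝ V]
    [FiniteDimensional ℝ V] {Γ L Λ : Subgroup (LinearMap.GeneralLinearGroup ℝ V)}
    (hL : IsCompactSubgroup L) (hΛ : Λ ≤ Γ ⊓ L) (hfin : Λ.IsFiniteRelIndex (Γ ⊓ L))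
    (hsep : IsSeparableSubgroup (Λ.subgroupOf Γ)) : IsLinearOver ℝ (Double (Λ.subgroupOf Γ)) := by
  let : TopologicalSpace (Module.End ℝ V) := moduleTopology ℝ (Module.End ℝ V)
  have : IsModuleTopology ℝ (Module.End ℝ V) := ⟨rfl⟩
  have : ContinuousInv (Module.End ℝ V)ˣ :=
    ⟨Units.continuous_iff.2 ⟨Units.continuous_coe_inv, by simpa using Units.continuous_val⟩⟩
  refine isLinearOver_double_of_isCompact_end (G := (Module.End ℝ V)ˣ) Γ.subtype
    Γ.subtype_injective L hL (Units.coeHom _) Units.val_injective (fun f => ?_)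
    (fun x hx => (hΛ hx).2) (isFiniteRelIndex_subgroupOf hfin) hsep
  exact (IsModuleTopology.continuous_of_linearMap f).comp Units.continuous_val

/-- Complex matrices acting on `ℂⁿ` as a real vector space. -/
noncomputable def realAction (n : ℕ) :
    Matrix (Fin n) (Fin n) ℂ →ₐ[ℝ] Module.End ℝ (Fin n → ℂ) where
  toFun g := (Matrix.toLin' g).restrictScalars ℝ
  map_one' := by ext; simp
  map_mul' g h := by rw [Matrix.toLin'_mul]; rfl
  map_zero' := by rw [map_zero]; rfl
  map_add' g h := by rw [map_add]; rfl
  commutes' r := by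
    refine LinearMap.ext fun v => ?_
    have : algebraMap ℝ (Matrix (Fin n) (Fin n) ℂ) r = (r : ℂ) • 1 := by
      rw [Algebra.algebraMap_eq_smul_one]; ext; simp
    rw [this]
    ext i
    simp [Matrix.smul_mulVec]

theorem realAction_injective (n : ℕ) : Function.Injective (realAction n) :=
  (LinearMap.restrictScalars_injective ℝ).comp Matrix.toLin'.injective

theorem toEntryField_injective {n : ℕ} {k : Type*} [Field k]
    (Γ : Subgroup (Matrix.GeneralLinearGroup (Fin n) k)) :
    Function.Injective (toEntryField Γ) := by
  intro a b h
  refine Subtype.ext (Units.ext (Matrix.ext fun i j => ?_))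
  exact congrArg (fun M : Matrix.GeneralLinearGroup (Fin n) (entryField Γ) => (M.val i j : k)) h

theorem conjugate_injective {n : ℕ} {k : Type*} [Field k]
    (Γ : Subgroup (Matrix.GeneralLinearGroup (Fin n) k)) (σ : entryField Γ →+* k) :
    Function.Injective (conjugate Γ σ) := by
  intro a b h
  refine toEntryField_injective Γ (Units.ext (Matrix.ext fun i j => σ.injective ?_))
  exact congrArg (fun M : Matrix.GeneralLinearGroup (Fin n) k => M.val i j) h

/-- A linear functional on the field `k` over the subfield `K`, applied to the coefficients of a
polynomial. -/
noncomputable def mapCoeffs {n : ℕ} {k : Type*} [Field k] {K : Subfield k} (f : k →ₗ[K] K)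
    (p : MvPolynomial (Fin n × Fin n) k) : MvPolynomial (Fin n × Fin n) K :=
  ∑ s ∈ p.support, MvPolynomial.monomial s (f (p.coeff s))

/-- At a matrix over `K` every monomial takes a value in `K`, which passes through `f`. -/
theorem evalMatrix_mapCoeffs {n : ℕ} {k : Type*} [Field k] {K : Subfield k} (f : k →ₗ[K] K)
    (p : MvPolynomial (Fin n × Fin n) k) (x : Matrix (Fin n) (Fin n) K) :
    evalMatrix x (mapCoeffs f p) = f (evalMatrix (x.map (algebraMap K k)) p) := by
  rw [mapCoeffs, map_sum, MvPolynomial.eval_eq, map_sum]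
  refine Finset.sum_congr rfl fun s _ => ?_
  rw [MvPolynomial.eval_monomial, mul_comm, ← smul_eq_mul, ← map_smul, Algebra.smul_def,
    mul_comm (algebraMap K k _), Finsupp.prod, map_prod]
  simp

/-- The Galois conjugate of the intersection of `Γ` with an algebraic group is closed in the
conjugate of `Γ`. -/
theorem comap_conjugate_closure {n : ℕ} {k : Type*} [Field k] [TopologicalSpace k]
    [IsTopologicalRing k] [T1Space k] (Γ G : Subgroup (Matrix.GeneralLinearGroup (Fin n) k))
    (hG : IsAlgebraicSubgroup G) (σ : entryField Γ →+* k) (γ : Γ)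
    (hγ : conjugate Γ σ γ ∈ closure
      ((G.subgroupOf Γ).map (conjugate Γ σ) : Set (Matrix.GeneralLinearGroup (Fin n) k))) :
    γ ∈ G.subgroupOf Γ := by
  obtain ⟨S, hS⟩ := hG
  rw [Subgroup.mem_subgroupOf, hS]
  intro p hp
  -- The coefficients of `p` need not lie in the domain of `σ`. Linear functionals over the entry
  -- field detect the vanishing of `p` and replace it by polynomials to which `σ` applies.
  rw [← Module.forall_dual_apply_eq_zero_iff (entryField Γ)]
  intro f
  have hval : ∀ δ : Γ, f (evalMatrix δ.1.val p) =
      evalMatrix (entryMatrix Γ δ) (mapCoeffs f p) := fun δ => by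
    rw [evalMatrix_mapCoeffs]
    rfl
  have hconj : ∀ δ : Γ, evalMatrix (conjugate Γ σ δ).val (MvPolynomial.map σ (mapCoeffs f p)) =
      σ (evalMatrix (entryMatrix Γ δ) (mapCoeffs f p)) := fun δ => by
    rw [MvPolynomial.eval_map]
    exact (MvPolynomial.eval₂_comp_left σ (RingHom.id _) _ _).symm
  have hclosed : IsClosed {g : Matrix.GeneralLinearGroup (Fin n) k |
      evalMatrix g.val (MvPolynomial.map σ (mapCoeffs f p)) = 0} :=
    isClosed_singleton.preimage ((continuous_evalMatrix _).comp Units.continuous_val)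
  have hmem := closure_minimal (t := {g : Matrix.GeneralLinearGroup (Fin n) k |
      evalMatrix g.val (MvPolynomial.map σ (mapCoeffs f p)) = 0}) (by
    rintro _ ⟨δ, hδ, rfl⟩
    have : evalMatrix δ.1.val p = 0 := (hS _).1 (Subgroup.mem_subgroupOf.1 hδ) p hp
    rw [Set.mem_ofPred_eq, hconj, ← hval, this, map_zero, map_zero]) hclosed hγ
  rw [Set.mem_ofPred_eq, hconj, map_eq_zero, ← hval] at hmem
  exact hmem

theorem isLinearOver_double_of_isCompact_conjugate {n : ℕ}
    {Γ G Λ : Subgroup (Matrix.GeneralLinearGroup (Fin n) ℂ)} (hG : IsAlgebraicSubgroup G)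
    (hΛ : Λ ≤ Γ ⊓ G) (hfin : Λ.IsFiniteRelIndex (Γ ⊓ G))
    (hsep : IsSeparableSubgroup (Λ.subgroupOf Γ)) (σ : entryField Γ →+* ℂ)
    (hσ : IsCompact (closure ((G.subgroupOf Γ).map (conjugate Γ σ) :
      Set (Matrix.GeneralLinearGroup (Fin n) ℂ)))) :
    IsLinearOver ℝ (Double (Λ.subgroupOf Γ)) := by
  let L := ((G.subgroupOf Γ).map (conjugate Γ σ)).topologicalClosure
  -- Taking the closure adds no element of `Γ^σ`, so the index of `Λ` stays finite.
  have hL : L.comap (conjugate Γ σ) = G.subgroupOf Γ := by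
    refine le_antisymm (fun γ hγ => comap_conjugate_closure Γ G hG σ γ hγ) fun γ hγ => ?_
    exact Subgroup.le_topologicalClosure _ (Subgroup.mem_map_of_mem _ hγ)
  refine isLinearOver_double_of_isCompact_end (conjugate Γ σ) (conjugate_injective Γ σ) L hσ
    ((realAction n).toRingHom.toMonoidHom.comp (Units.coeHom _))
    ((realAction_injective n).comp Units.val_injective) (fun f => ?_)
    ?_ ?_ hsep
  · exact (f.comp (realAction n).toLinearMap).continuous_of_finiteDimensional.comp
      Units.continuous_val
  · rw [hL]
    exact fun x hx => (hΛ hx).2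
  · rw [hL]
    exact isFiniteRelIndex_subgroupOf hfin

end LinearDoubles

theorem corollary1p3 :
    (∀ (V : Type*) [AddCommGroup V] [Module ℝ V] [FiniteDimensional ℝ V]
      (Γ L Λ : Subgroup (LinearMap.GeneralLinearGroup ℝ V)),
      LinearDoubles.IsCompactSubgroup L →
      Λ ≤ Γ ⊓ L →
      Λ.IsFiniteRelIndex (Γ ⊓ L) →
      LinearDoubles.IsSeparableSubgroup (Λ.subgroupOf Γ) →
      LinearDoubles.IsLinearOver ℝ (LinearDoubles.Double (Λ.subgroupOf Γ))) ∧
    (∀ (n : ℕ) (Γ G Λ : Subgroup (Matrix.GeneralLinearGroup (Fin n) ℂ)),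
      LinearDoubles.IsAlgebraicSubgroup G →
      Λ ≤ Γ ⊓ G →
      Λ.IsFiniteRelIndex (Γ ⊓ G) →
      LinearDoubles.IsSeparableSubgroup (Λ.subgroupOf Γ) →
      (∃ σ : LinearDoubles.entryField Γ →+* ℂ,
        IsCompact (closure (((G.subgroupOf Γ).map (LinearDoubles.conjugate Γ σ) :
          Subgroup (Matrix.GeneralLinearGroup (Fin n) ℂ)) :
            Set (Matrix.GeneralLinearGroup (Fin n) ℂ)))) →
      LinearDoubles.IsLinearOver ℝ (LinearDoubles.Double (Λ.subgroupOf Γ))) := by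
  refine ⟨?_, ?_⟩
  · intro V _ _ _ Γ L Λ hL hΛ hfin hsep
    exact LinearDoubles.isLinearOver_double_of_isCompactSubgroup hL hΛ hfin hsep
  · rintro n Γ G Λ hG hΛ hfin hsep ⟨σ, hσ⟩
    exact LinearDoubles.isLinearOver_double_of_isCompact_conjugate hG hΛ hfin hsep σ hσ
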